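/- A lattice is a discrete subgroup $\Lambda$ of $\mathbb{R}^2$ that spans $\mathbb{R}^2$ over $\mathbb{R}$, and $|S|$ denotes the area of $S\subset\mathbb{R}^2$. For a bounded measurable set $K\subset\mathbb{R}^2$ and a lattice $\Lambda$, let $K+\Lambda$ denote the family of translates $(K+v)_{v\in\Lambda}$. For a positive integer $j$, the family $K+\Lambda$ is a $j$-fold lattice packing of $\mathbb{R}^2$ if every point of $\mathbb{R}^2$ belongs to the interiors of at most $j$ members of the family, and a $j$-fold lattice covering of $\mathbb{R}^2$ if every point of $\mathbb{R}^2$ belongs to at least $j$ members. With $Q_l=[-l,l]^2$, put $$d_+(K+\Lambda)=\limsup_{l\to\infty}\frac{1}{|Q_l|}\sum_{v\in\Lambda,\ (K+v)\cap Q_l\neq\emptyset}|K+v|,\qquad d_-(K+\Lambda)=\liminf_{l\to\infty}\frac{1}{|Q_l|}\sum_{v\in\Lambda,\ K+v\subset Q_l}|K+v|.$$ The $j$-fold lattice packing density $\delta_L^j(K)$ is the supremum of $d_+(K+\Lambda)$ over all $j$-fold lattice packings $K+\Lambda$ of $\mathbb{R}^2$, and the $j$-fold lattice covering density $\vartheta_L^j(K)$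 is the infimum of $d_-(K+\Lambda)$ over all $j$-fold lattice coverings $K+\Lambda$ of $\mathbb{R}^2$. **Theorem 1.** For every (closed, non-degenerate) triangle $T\subset\mathbb{R}^2$ and every positive integer $j$, $$\delta_L^j(T)=\frac{2j^2}{2j+1}\qquad\text{and}\qquad \vartheta_L^j(T)=\frac{2j+1}{2}.$$ -/

import Mathlib

open MeasureTheory Filter
open scoped ENNReal Pointwise

/-- The Euclidean plane `ℝ²`, with its Lebesgue measure `volume`. -/
abbrev Plane : Type := EuclideanSpace ℝ (Fin 2)

noncomputable section

/-- The square `l I²`, where `I = [-1, 1]`. -/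
def square (l : ℝ) : Set Plane := {x | ∀ i, x i ∈ Set.Icc (-l) l}

/-- `d₊(F, D)`: the total area of the members of the family `F` that meet `D`, divided by `|D|`. -/
def upperDensityIn {ι : Type*} (F : ι → Set Plane) (D : Set Plane) : ℝ≥0∞ :=
  (∑' i : {i : ι // (F i ∩ D).Nonempty}, volume (F i)) / volume D

/-- `d₋(F, D)`: the total area of the members of the family `F` contained in `D`,
divided by `|D|`. -/
def lowerDensityIn {ι : Type*} (F : ι → Set Plane) (D : Set Plane) : ℝ≥0∞ :=
  (∑' i : {i : ι // F i ⊆ D}, volume (F i)) / volume D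

/-- The upper density `d₊(F) = limsup_{l → ∞} d₊(F, l I²)`. -/
def upperDensity {ι : Type*} (F : ι → Set Plane) : ℝ≥0∞ :=
  limsup (fun l : ℝ => upperDensityIn F (square l)) atTop

/-- The lower density `d₋(F) = liminf_{l → ∞} d₋(F, l I²)`. -/
def lowerDensity {ι : Type*} (F : ι → Set Plane) : ℝ≥0∞ :=
  liminf (fun l : ℝ => lowerDensityIn F (square l)) atTop

/-- `F` is a `j`-fold packing of `D`: its members lie in `D`, and each point of `D` belongs to the
interiors of at most `j` members. -/
def IsMultiplePacking {ι : Type*} (j : ℕ) (F : ι → Set Plane) (D : Set Plane) : Prop :=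
  (⋃ i, F i) ⊆ D ∧ ∀ x ∈ D, {i | x ∈ interior (F i)}.encard ≤ j

/-- `F` is a `j`-fold covering of `D`: each point of `D` belongs to at least `j` members. -/
def IsMultipleCovering {ι : Type*} (j : ℕ) (F : ι → Set Plane) (D : Set Plane) : Prop :=
  ∀ x ∈ D, (j : ℕ∞) ≤ {i | x ∈ F i}.encard

/-- `Λ` is a lattice of `ℝ²`: a discrete additive subgroup that spans the plane. -/
def IsPlaneLattice (Λ : Submodule ℤ Plane) : Prop :=
  ∃ _ : DiscreteTopology Λ, IsZLattice ℝ Λ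

/-- The family `K + Λ` of the translates `K + v` of `K` by the vectors `v` of `Λ`. -/
def latticeFamily (K : Set Plane) (Λ : Submodule ℤ Plane) : Λ → Set Plane :=
  fun v => (v : Plane) +ᵥ K

/-- The `j`-fold lattice packing density of `K`: the supremum of the upper densities of
the `j`-fold lattice packings `K + Λ` of the plane. -/
def latticePackingDensity (j : ℕ) (K : Set Plane) : ℝ≥0∞ :=
  ⨆ (Λ : Submodule ℤ Plane) (_ : IsPlaneLattice Λ)
    (_ : IsMultiplePacking j (latticeFamily K Λ) Set.univ), upperDensity (latticeFamily K Λ)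

/-- The `j`-fold lattice covering density of `K`: the infimum of the lower densities of
the `j`-fold lattice coverings `K + Λ` of the plane. -/
def latticeCoveringDensity (j : ℕ) (K : Set Plane) : ℝ≥0∞ :=
  ⨅ (Λ : Submodule ℤ Plane) (_ : IsPlaneLattice Λ)
    (_ : IsMultipleCovering j (latticeFamily K Λ) Set.univ), lowerDensity (latticeFamily K Λ)

end

/-!
An affine change of coordinates turns the triangle into the standard triangle `x, y ≥ 0`,
`x + y ≤ 1`, and both densities of the family become the quotient of the area of the triangle by
the area `d` of a fundamental domain (`tendsto_densityIn`). It remains to bound `d`, from below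
for packings and from above for coverings.

Order the plane by `x + y`, ties being broken by `x`; this order is invariant under translations.
From each coset of the lattice keep the `j` first points of the closed quadrant `x, y ≥ 0`. The
points kept form a set `staircase j L`, which meets every coset in at most `j` points and therefore
has area at most `j * d`; if every coset has at least `j` points in the quadrant, the area is
`j * d`. The staircase contains the interior of the triangle if the triangle gives a `j`-fold
packing, and it lies in the triangle if the triangle gives a `j`-fold covering.

The staircase has at most `2 * j` corners (`exists_jumps`). Indeed, a vertical edge of abscissa `a`
comes from a positive lattice point of abscissa `a`. If some such point can be taken on or below
the horizontal axis, then `a` is one of the `j` smallest abscissae of positive lattice points in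
that half-plane. Otherwise the lowest one lies in the quadrant and is preceded by at most `j`
lattice points of the quadrant, so that, the origin being excluded, there are at most `j`
possibilities.

A staircase with at most `2 * j` corners inside the triangle meets the diagonal `x + y = t` in
length at most `min t (2 * j * (1 - t))`, and one that contains the open triangle meets
`x + y = 1 + t` in length at least `1 - 2 * j * t`. Integrating over the diagonals bounds the area
by `j / (2 * j + 1)` from above (`volume_staircase_le`) and by `(2 * j + 1) / (4 * j)` from below
(`le_volume_staircase`).

Equality holds for the lattice of the integer points `(a, b)` with `a ≡ b` modulo `2 * j + 1`: the
unit cells with corners `(r, q)`, `r, q ≥ 0`, `r + q < 2 * j`, form a `j`-fold tile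
(`encard_stairCells`), which contains the open standard triangle of side `2 * j` and is contained
in the closed one of side `2 * j + 1`.
-/

/-! ### First elements of a subset of a linear order -/

/-- At most `n` elements of a set have fewer than `n` predecessors in it. -/
theorem Set.encard_setOf_encard_lt_le {α β : Type*} [LinearOrder β] (κ : α → β)
    (hκ : Function.Injective κ) (B : Set α) (n : ℕ) :
    {v | v ∈ B ∧ {w | w ∈ B ∧ κ w < κ v}.encard < n}.encard ≤ n := by
  by_contra! h
  obtain ⟨t, htC, ht⟩ := Set.exists_subset_encard_eq (k := (n : ℕ∞) + 1) (Order.add_one_le_of_lt h)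
  have hfin : t.Finite := Set.finite_of_encard_eq_coe (k := n + 1) (by simpa using ht)
  have hne : t.Nonempty := by
    rw [← Set.encard_ne_zero, ht]; simp
  obtain ⟨v, hv, hmax⟩ := Set.exists_max_image t κ hfin hne
  have hsub : t \ {v} ⊆ {w | w ∈ B ∧ κ w < κ v} := fun w hw =>
    ⟨(htC hw.1).1, lt_of_le_of_ne (hmax w hw.1) fun h => hw.2 (hκ h)⟩
  have h1 := Set.encard_sdiff_singleton_add_one hv
  rw [ht] at h1
  have h2 : (t \ {v}).encard = n := by
    have := hfin.sdiff (t := {v})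
    rw [this.encard_eq_coe] at h1 ⊢
    exact_mod_cast Nat.succ_injective (by exact_mod_cast h1)
  exact absurd ((Set.encard_le_encard hsub).trans_lt (htC hv).2) (by rw [h2]; exact lt_irrefl _)

/-- If initial segments are finite and the set has at least `n` elements, then at least `n` of them
have fewer than `n` predecessors. -/
theorem Set.le_encard_setOf_encard_lt {α β : Type*} [LinearOrder β] (κ : α → β) (B : Set α)
    (hfin : ∀ v ∈ B, {w | w ∈ B ∧ κ w < κ v}.Finite) (n : ℕ) (hB : n ≤ B.encard) :
    n ≤ {v | v ∈ B ∧ {w | w ∈ B ∧ κ w < κ v}.encard < n}.encard := by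
  by_contra! h
  set C := {v | v ∈ B ∧ {w | w ∈ B ∧ κ w < κ v}.encard < n} with hC
  have hne : (B \ C).Nonempty := by
    rw [Set.sdiff_nonempty]
    exact fun hs => absurd ((hB.trans (Set.encard_le_encard hs)).trans_lt h) (lt_irrefl _)
  -- an element outside `C` with the fewest predecessors
  obtain ⟨v, ⟨hvB, hvC⟩, hmin⟩ :=
    exists_minimalFor_of_wellFoundedLT (· ∈ B \ C) (fun v => {w | w ∈ B ∧ κ w < κ v}.ncard) hne
  have hv : (n : ℕ∞) ≤ {w | w ∈ B ∧ κ w < κ v}.encard := by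
    by_contra! h'; exact hvC ⟨hvB, h'⟩
  obtain ⟨w, ⟨hwB, hwv⟩, hwC⟩ : ({w | w ∈ B ∧ κ w < κ v} \ C).Nonempty := by
    rw [Set.sdiff_nonempty]
    exact fun hs => absurd ((hv.trans (Set.encard_le_encard hs)).trans_lt h) (lt_irrefl _)
  have hlt : {u | u ∈ B ∧ κ u < κ w}.ncard < {u | u ∈ B ∧ κ u < κ v}.ncard := by
    refine Set.ncard_lt_ncard ⟨fun u hu => ⟨hu.1, hu.2.trans hwv⟩, fun hs => ?_⟩ (hfin v hvB)
    exact lt_irrefl _ (hs (⟨hwB, hwv⟩ : w ∈ {u | u ∈ B ∧ κ u < κ v})).2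
  exact absurd (hmin ⟨hwB, hwC⟩ hlt.le) (not_le.2 hlt)

/-! ### The staircase of a planar lattice -/

/-- The key by which points of the plane are ordered: first by the sum of the coordinates, then by
the first coordinate. Being additive and injective, it defines a translation-invariant linear
order. -/
noncomputable def sumLex : ℝ × ℝ →+ ℝ ×ₗ ℝ where
  toFun u := toLex (u.1 + u.2, u.1)
  map_zero' := by simp
  map_add' u v := by
    simp only [Prod.fst_add, Prod.snd_add]
    rw [← toLex_add]
    congr 1
    ext
    · simp; ring
    · simp

theorem sumLex_pos_iff {u : ℝ × ℝ} : 0 < sumLex u ↔ 0 < u.1 + u.2 ∨ (0 = u.1 + u.2 ∧ 0 < u.1) := by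
  change (toLex (0, 0) : ℝ ×ₗ ℝ) < toLex (u.1 + u.2, u.1) ↔ _
  rw [Prod.Lex.toLex_lt_toLex]

theorem sumLex_injective : Function.Injective sumLex := by
  intro u v h
  have h' : ((u.1 + u.2, u.1) : ℝ × ℝ) = (v.1 + v.2, v.1) := toLex.injective h
  simp only [Prod.mk.injEq] at h'
  ext <;> linarith [h'.1, h'.2]

theorem sumLex_nonneg {u : ℝ × ℝ} (h : 0 ≤ u) : 0 ≤ sumLex u := by
  rcases h.eq_or_lt with rfl | h0
  · simp
  · refine (sumLex_pos_iff.2 ?_).le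
    have h1 : 0 ≤ u.1 := h.1
    have h2 : 0 ≤ u.2 := h.2
    by_contra! hc
    have : u.1 = 0 := by linarith [hc.1]
    have : u.2 = 0 := by linarith [hc.1]
    exact h0.ne (by ext <;> simp [*])

theorem sumLex_lt_iff {u v : ℝ × ℝ} : sumLex u < sumLex v ↔ 0 < sumLex (v - u) := by
  rw [map_sub, sub_pos]

/-- The elements of `L` that are positive for the order of `sumLex` and below `p` for the product
order. Subtracting them from `p` gives the points of the quadrant that are congruent to `p` and
precede it. -/
def posBelow (L : AddSubgroup (ℝ × ℝ)) (p : ℝ × ℝ) : Set (ℝ × ℝ) :=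
  {u | u ∈ L ∧ 0 < sumLex u ∧ u ≤ p}

/-- The points of the closed quadrant preceded, in their coset modulo `L`, by fewer than `j` points
of the quadrant. -/
def staircase (j : ℕ) (L : AddSubgroup (ℝ × ℝ)) : Set (ℝ × ℝ) :=
  {p | 0 ≤ p ∧ (posBelow L p).encard < j}

theorem posBelow_mono (L : AddSubgroup (ℝ × ℝ)) : Monotone (posBelow L) :=
  fun _ _ h _ hu => ⟨hu.1, hu.2.1, hu.2.2.trans h⟩

theorem finite_posBelow {L : AddSubgroup (ℝ × ℝ)} (hL : ∀ p q, {u | u ∈ L ∧ u ∈ Set.Icc p q}.Finite)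
    (p : ℝ × ℝ) : (posBelow L p).Finite := by
  refine (hL (-p.2, -p.1) p).subset fun u hu => ⟨hu.1, ?_, hu.2.2⟩
  have h1 : u.1 ≤ p.1 := hu.2.2.1
  have h2 : u.2 ≤ p.2 := hu.2.2.2
  constructor <;> rcases sumLex_pos_iff.1 hu.2.1 with h | h <;> simp only <;> linarith

/-- Up to a translation by `v`, the lattice vectors that carry `p` to a point of the quadrant
preceding `p - v` are the elements of `posBelow L (p - v)`. -/
theorem encard_preds {L : AddSubgroup (ℝ × ℝ)} (p : ℝ × ℝ) {v : ℝ × ℝ} (hv : v ∈ L) :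
    {w | (w ∈ L ∧ 0 ≤ p - w) ∧ sumLex (p - w) < sumLex (p - v)} = (v + ·) '' posBelow L (p - v) := by
  ext w
  simp only [Set.mem_ofPred_eq, Set.mem_image, posBelow, sumLex_lt_iff]
  constructor
  · rintro ⟨⟨hw, hpw⟩, hlt⟩
    refine ⟨w - v, ⟨L.sub_mem hw hv, by simpa using hlt, ?_⟩, by abel⟩
    exact sub_le_sub_right (sub_nonneg.1 hpw) v
  · rintro ⟨u, ⟨hu, hpos, hle⟩, rfl⟩
    refine ⟨⟨L.add_mem hv hu, ?_⟩, by simpa using hpos⟩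
    rw [← sub_sub]; exact sub_nonneg.2 hle

theorem staircase_translates_eq (j : ℕ) (L : AddSubgroup (ℝ × ℝ)) (p : ℝ × ℝ) :
    {v | v ∈ L ∧ p - v ∈ staircase j L} =
      {v | v ∈ {w | w ∈ L ∧ 0 ≤ p - w} ∧
        {w | w ∈ {w | w ∈ L ∧ 0 ≤ p - w} ∧ sumLex (p - w) < sumLex (p - v)}.encard < j} := by
  ext v
  simp only [Set.mem_ofPred_eq, staircase, and_assoc]
  refine and_congr_right fun hv => and_congr_right fun _ => ?_
  have := encard_preds p hv
  simp only [and_assoc] at this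
  rw [this, (add_right_injective v).encard_image]

theorem encard_staircase_translates_le (j : ℕ) (L : AddSubgroup (ℝ × ℝ)) (p : ℝ × ℝ) :
    {v | v ∈ L ∧ p - v ∈ staircase j L}.encard ≤ j := by
  rw [staircase_translates_eq]
  exact Set.encard_setOf_encard_lt_le (fun v => sumLex (p - v))
    (sumLex_injective.comp (sub_right_injective)) _ j

theorem le_encard_staircase_translates {j : ℕ} {L : AddSubgroup (ℝ × ℝ)}
    (hL : ∀ p q, {u | u ∈ L ∧ u ∈ Set.Icc p q}.Finite) {p : ℝ × ℝ}
    (h : (j : ℕ∞) ≤ {v | v ∈ L ∧ 0 ≤ p - v}.encard) :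
    j ≤ {v | v ∈ L ∧ p - v ∈ staircase j L}.encard := by
  rw [staircase_translates_eq]
  refine Set.le_encard_setOf_encard_lt (fun v => sumLex (p - v)) _ (fun v hv => ?_) j h
  exact (encard_preds p hv.1) ▸ (finite_posBelow hL _).image _

/-- The closed triangle with vertices `(0, 0)`, `(1, 0)`, `(0, 1)`. -/
def stdTriangle : Set (ℝ × ℝ) := {p | 0 ≤ p.1 ∧ 0 ≤ p.2 ∧ p.1 + p.2 ≤ 1}

/-- The open triangle with vertices `(0, 0)`, `(1, 0)`, `(0, 1)`. -/
def stdTriangleInterior : Set (ℝ × ℝ) := {p | 0 < p.1 ∧ 0 < p.2 ∧ p.1 + p.2 < 1}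

theorem staircase_subset_of_covering {j : ℕ} {L : AddSubgroup (ℝ × ℝ)}
    (h : ∀ p, (j : ℕ∞) ≤ {v | v ∈ L ∧ p - v ∈ stdTriangle}.encard) :
    staircase j L ⊆ stdTriangle := by
  rintro p ⟨hp, hlt⟩
  refine ⟨hp.1, hp.2, ?_⟩
  by_contra! hs
  refine absurd (((h p).trans (Set.encard_le_encard ?_)).trans_lt hlt) (lt_irrefl _)
  rintro v ⟨hv, h1, h2, h3⟩
  simp only [Prod.fst_sub, Prod.snd_sub] at h1 h2 h3
  exact ⟨hv, sumLex_pos_iff.2 (Or.inl (by linarith)), by linarith, by linarith⟩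

theorem subset_staircase_of_packing {j : ℕ} {L : AddSubgroup (ℝ × ℝ)}
    (h : ∀ p, {v | v ∈ L ∧ p - v ∈ stdTriangleInterior}.encard ≤ j) :
    stdTriangleInterior ⊆ staircase j L := by
  rintro p ⟨h1, h2, h3⟩
  refine ⟨⟨h1.le, h2.le⟩, ?_⟩
  -- moving `p` slightly up and right makes the points of `posBelow L p` strictly below it
  set ε := (1 - p.1 - p.2) / 3 with hε
  have hε0 : 0 < ε := by rw [hε]; linarith
  have hsub : insert 0 (posBelow L p) ⊆ {v | v ∈ L ∧ (p + (ε, ε)) - v ∈ stdTriangleInterior} := by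
    rintro v (rfl | ⟨hv, hpos, hle⟩)
    · refine ⟨L.zero_mem, ?_, ?_, ?_⟩ <;> simp <;> linarith
    · have e1 : v.1 ≤ p.1 := hle.1
      have e2 : v.2 ≤ p.2 := hle.2
      have e3 : 0 ≤ v.1 + v.2 := by
        rcases sumLex_pos_iff.1 hpos with h | h <;> linarith
      refine ⟨hv, ?_, ?_, ?_⟩ <;> simp <;> linarith
  have h0 : (0 : ℝ × ℝ) ∉ posBelow L p := fun h => by simpa using h.2.1
  have := (Set.encard_le_encard hsub).trans (h _)
  rw [Set.encard_insert_of_notMem h0] at this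
  have hfin : (posBelow L p).encard ≠ ⊤ := fun ht => by simp [ht] at this
  exact (ENat.add_one_le_iff hfin).1 this

/-- A staircase has at most `2 * j` vertical edges: each row that leaves the staircase does so
at one of at most `2 * j` abscissae. -/
theorem exists_jumps {j : ℕ} (hj : 0 < j) {L : AddSubgroup (ℝ × ℝ)}
    (hL : ∀ p q, {u | u ∈ L ∧ u ∈ Set.Icc p q}.Finite) :
    ∃ A : Finset ℝ, A.card ≤ 2 * j ∧ ∀ x x' y : ℝ, 0 ≤ x → x < x' → (x, y) ∈ staircase j L →
      (x', y) ∉ staircase j L →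
      ∃ a ∈ A, x < a ∧ a ≤ x' ∧ (a, y) ∉ staircase j L ∧
        ∀ z, 0 ≤ z → z < a → (z, y) ∈ staircase j L := by
  -- `A₁`: the `j` smallest abscissae of positive lattice points on or below the axis;
  -- `A₂`: the abscissae of the nonzero lattice points of the quadrant with at most `j` predecessors
  set V : Set ℝ := Prod.fst '' {u : ℝ × ℝ | u ∈ L ∧ 0 < sumLex u ∧ u.2 ≤ 0} with hV
  set A₁ : Set ℝ := {a | a ∈ V ∧ {b | b ∈ V ∧ id b < id a}.encard < j} with hA₁
  set C : Set (ℝ × ℝ) := {u | u ∈ {w | w ∈ L ∧ 0 ≤ w} ∧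
    {w | w ∈ {w | w ∈ L ∧ 0 ≤ w} ∧ sumLex w < sumLex u}.encard < (j + 1 : ℕ)} with hC
  set A₂ : Set ℝ := Prod.fst '' (C \ {0}) with hA₂
  have hc₁ : A₁.encard ≤ j := Set.encard_setOf_encard_lt_le id Function.injective_id V j
  have hc₂ : A₂.encard ≤ j := by
    refine (Set.encard_image_le _ _).trans ?_
    have h0 : (0 : ℝ × ℝ) ∈ C := by
      refine ⟨⟨L.zero_mem, le_rfl⟩, ?_⟩
      have : {w | w ∈ {w | w ∈ L ∧ 0 ≤ w} ∧ sumLex w < sumLex 0} = ∅ := by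
        ext w
        simp only [Set.mem_ofPred_eq, map_zero, Set.mem_empty_iff_false, iff_false, not_and, not_lt]
        exact fun hw => sumLex_nonneg hw.2
      rw [this]; simp
    have h1 := Set.encard_setOf_encard_lt_le sumLex sumLex_injective {w | w ∈ L ∧ 0 ≤ w} (j + 1)
    rw [← hC, ← Set.encard_sdiff_singleton_add_one h0] at h1
    push_cast at h1
    exact (ENat.add_le_add_iff_right (by simp)).1 h1
  have hc : (A₁ ∪ A₂).encard ≤ (2 * j : ℕ) := by
    refine (Set.encard_union_le _ _).trans ((add_le_add hc₁ hc₂).trans ?_)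
    push_cast; rw [two_mul]
  have hfin : (A₁ ∪ A₂).Finite := Set.finite_of_encard_le_coe hc
  refine ⟨hfin.toFinset, ?_, ?_⟩
  · rw [hfin.encard_eq_coe_toFinset_card] at hc
    exact_mod_cast hc
  intro x x' y hx hxx' hS hS'
  have hy : 0 ≤ y := hS.1.2
  have hP' : (j : ℕ∞) ≤ (posBelow L (x', y)).encard := by
    by_contra! h; exact hS' ⟨⟨hx.trans hxx'.le, hy⟩, h⟩
  -- the smallest abscissa at which the row at height `y` leaves the staircase
  set G : Set (ℝ × ℝ) := {u | u ∈ posBelow L (x', y) ∧ (j : ℕ∞) ≤ (posBelow L (u.1, y)).encard}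
    with hG
  have key : ∀ s : Set (ℝ × ℝ), s ⊆ posBelow L (x', y) → (j : ℕ∞) ≤ s.encard →
      ∃ u ∈ s, u ∈ G := by
    intro s hs hjs
    have hne : s.Nonempty := by
      rw [← Set.encard_ne_zero]
      rintro h; rw [h] at hjs; simp at hjs; omega
    obtain ⟨u, hu, hmax⟩ := Set.exists_max_image s Prod.fst ((finite_posBelow hL _).subset hs) hne
    refine ⟨u, hu, hs hu, hjs.trans (Set.encard_le_encard fun w hw => ?_)⟩
    exact ⟨(hs hw).1, (hs hw).2.1, hmax w hw, (hs hw).2.2.2⟩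
  obtain ⟨u₀, -, hu₀⟩ := key _ subset_rfl hP'
  obtain ⟨u₁, hu₁, hmin⟩ := Set.exists_min_image G Prod.fst
    ((finite_posBelow hL (x', y)).subset fun u hu => hu.1) ⟨u₀, hu₀⟩
  set a := u₁.1 with ha
  have hax' : a ≤ x' := hu₁.1.2.2.1
  have hxa : x < a := by
    by_contra! h
    refine absurd (hu₁.2.trans_lt ((Set.encard_le_encard (posBelow_mono L ?_)).trans_lt hS.2))
      (lt_irrefl _)
    exact ⟨h, le_rfl⟩
  set R : Set (ℝ × ℝ) := {u | u ∈ L ∧ 0 < sumLex u ∧ u.1 < a ∧ u.2 ≤ y} with hR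
  have hRj : R.encard < j := by
    by_contra! h
    obtain ⟨u, huR, huG⟩ := key R
      (fun u hu => ⟨hu.1, hu.2.1, hu.2.2.1.le.trans hax', hu.2.2.2⟩) h
    exact absurd (hmin u huG) (not_le.2 huR.2.2.1)
  refine ⟨a, ?_, hxa, hax', fun h => absurd (hu₁.2.trans_lt h.2) (lt_irrefl _), fun z hz hza =>
    ⟨⟨hz, hy⟩, (Set.encard_le_encard fun u hu => ?_).trans_lt hRj⟩⟩
  swap
  · exact ⟨hu.1, hu.2.1, lt_of_le_of_lt hu.2.2.1 hza, hu.2.2.2⟩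
  rw [Set.Finite.mem_toFinset]
  -- the lowest positive lattice point on the line of abscissa `a`
  obtain ⟨u, ⟨huP, hua⟩, hlow⟩ :=
    Set.exists_min_image {u | u ∈ posBelow L (x', y) ∧ u.1 = a} Prod.snd
    ((finite_posBelow hL (x', y)).subset fun u hu => hu.1) ⟨u₁, hu₁.1, rfl⟩
  rcases le_or_gt u.2 0 with hu2 | hu2
  · left
    refine ⟨⟨u, ⟨huP.1, huP.2.1, hu2⟩, hua⟩, ?_⟩
    have : {b | b ∈ V ∧ id b < id a} ⊆ Prod.fst '' R := by
      rintro _ ⟨⟨w, ⟨hw, hpos, hw2⟩, rfl⟩, hlt⟩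
      exact ⟨w, ⟨hw, hpos, hlt, hw2.trans hy⟩, rfl⟩
    exact ((Set.encard_le_encard this).trans (Set.encard_image_le _ _)).trans_lt hRj
  · right
    have hu0 : u ≠ 0 := by rintro rfl; simp at hu2
    refine ⟨u, ⟨⟨⟨huP.1, by rw [Prod.le_def]; exact ⟨by simp [hua]; linarith, hu2.le⟩⟩, ?_⟩, hu0⟩, hua⟩
    have hsub : {w | w ∈ {w | w ∈ L ∧ 0 ≤ w} ∧ sumLex w < sumLex u} ⊆ insert 0 ((u - ·) '' R) := by
      rintro w ⟨⟨hw, hw0⟩, hlt⟩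
      rw [sumLex_lt_iff] at hlt
      have h1 : 0 ≤ w.1 := hw0.1
      have h2 : 0 ≤ w.2 := hw0.2
      have huy : u.2 ≤ y := huP.2.2.2
      -- `u - w` is positive and below `u`; if it lies on the line of `u`, minimality gives `w = 0`
      rcases h1.eq_or_lt with h1 | h1
      · left
        have := hlow (u - w) ⟨⟨L.sub_mem huP.1 hw, hlt, ?_, ?_⟩, ?_⟩
        · simp only [Prod.snd_sub] at this
          ext
          · exact h1.symm
          · simp; linarith
        · simp [← h1, hua, hax']
        · simp; linarith
        · simp [← h1, hua]
      · right
        refine ⟨u - w, ⟨L.sub_mem huP.1 hw, hlt, ?_, ?_⟩, by simp⟩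
        · simp [hua, h1]
        · simp; linarith
    refine (Set.encard_le_encard hsub).trans_lt ((Set.encard_insert_le _ _).trans_lt ?_)
    refine (add_le_add_left (Set.encard_image_le _ _) 1).trans_lt ?_
    push_cast
    exact (ENat.add_lt_add_iff_right (by simp)).2 hRj

/-! ### The area of the staircase -/

theorem measurableSet_staircase (j : ℕ) (L : AddSubgroup (ℝ × ℝ)) [Countable L] :
    MeasurableSet (staircase j L) := by
  -- the complement of the staircase in the quadrant is a countable union of closed quadrants
  -- intersected `j` at a time
  have : staircase j L = Set.Ici 0 \ ⋃ s : Finset L,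
      ⋃ _ : s.card = j ∧ ∀ u ∈ s, 0 < sumLex (u : ℝ × ℝ),
      ⋂ u ∈ s, Set.Ici (u : ℝ × ℝ) := by
    ext p
    simp only [staircase, Set.mem_ofPred_eq, Set.mem_sdiff, Set.mem_Ici, Set.mem_iUnion,
      Set.mem_iInter, exists_prop, not_exists, not_and]
    refine and_congr_right fun _ => ?_
    rw [← not_le, ← not_iff_not]
    push Not
    classical
    constructor
    · intro h
      obtain ⟨t, ht, htj⟩ := Set.exists_subset_encard_eq h
      have hfin : t.Finite := Set.finite_of_encard_eq_coe htj
      have htL : ∀ u ∈ hfin.toFinset, u ∈ L := fun u hu => (ht (by simpa using hu)).1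
      refine ⟨hfin.toFinset.subtype (· ∈ L), ⟨?_, ?_⟩, ?_⟩
      · rw [Finset.card_subtype, Finset.filter_true_of_mem htL]
        rw [hfin.encard_eq_coe_toFinset_card] at htj
        exact_mod_cast htj
      · intro u hu; exact (ht (by simpa using hu)).2.1
      · intro u hu; exact (ht (by simpa using hu)).2.2
    · rintro ⟨s, ⟨hs, hpos⟩, hle⟩
      have : ((↑) : L → ℝ × ℝ) '' (s : Set L) ⊆ posBelow L p := by
        rintro _ ⟨u, hu, rfl⟩
        exact ⟨u.2, hpos u hu, hle u hu⟩
      rw [← hs, ← Set.encard_coe_eq_coe_finsetCard, ← Subtype.val_injective.encard_image]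
      exact Set.encard_le_encard this
  rw [this]
  refine measurableSet_Ici.diff (.iUnion fun s => .iUnion fun _ => ?_)
  exact .biInter s.countable_toSet fun u _ => measurableSet_Ici

/-- Area by slices along the diagonals `x + y = t`, each measured by its projection to the first
axis. -/
theorem volume_eq_lintegral_diagonal {A : Set (ℝ × ℝ)} (hA : MeasurableSet A) :
    volume A = ∫⁻ t, volume {x : ℝ | (x, t - x) ∈ A} := by
  have hA' : MeasurableSet {q : ℝ × ℝ | (q.1, q.2 - q.1) ∈ A} :=
    hA.preimage (by fun_prop : Measurable fun q : ℝ × ℝ => (q.1, q.2 - q.1))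
  rw [Measure.volume_eq_prod, Measure.prod_apply hA]
  have h1 : ∀ x : ℝ, volume (Prod.mk x ⁻¹' A) =
      volume (Prod.mk x ⁻¹' {q : ℝ × ℝ | (q.1, q.2 - q.1) ∈ A}) := fun x => by
    simpa [Set.preimage, sub_eq_add_neg] using
      (measure_preimage_add_right volume (-x) (Prod.mk x ⁻¹' A)).symm
  simp_rw [h1]
  rw [← Measure.prod_apply hA', Measure.prod_apply_symm hA']
  rfl

theorem lintegral_Ioc_linear {a b p q : ℝ} (hab : a ≤ b) (h : ∀ t ∈ Set.Ioc a b, 0 ≤ p + q * t) :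
    ∫⁻ t in Set.Ioc a b, ENNReal.ofReal (p + q * t) =
      ENNReal.ofReal (p * (b - a) + q * ((b ^ 2 - a ^ 2) / 2)) := by
  have hc : Continuous fun t : ℝ => p + q * t := by fun_prop
  rw [← ofReal_integral_eq_lintegral_ofReal
    (hc.integrableOn_Icc.mono_set Set.Ioc_subset_Icc_self)
    ((ae_restrict_iff' measurableSet_Ioc).2 (Eventually.of_forall h)),
    ← intervalIntegral.integral_of_le hab]
  congr 1
  rw [intervalIntegral.integral_add (Continuous.intervalIntegrable (by fun_prop) _ _)
      (Continuous.intervalIntegrable (by fun_prop) _ _),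
    intervalIntegral.integral_const, intervalIntegral.integral_const_mul, integral_id]
  simp only [smul_eq_mul]; ring

theorem measurableSet_stdTriangle : MeasurableSet stdTriangle :=
  (((isClosed_le continuous_const continuous_fst).inter
    ((isClosed_le continuous_const continuous_snd).inter
    (isClosed_le (continuous_fst.add continuous_snd) continuous_const)))).measurableSet

theorem volume_stdTriangle : volume stdTriangle = ENNReal.ofReal (1 / 2) := by
  rw [volume_eq_lintegral_diagonal measurableSet_stdTriangle]
  have : (fun t : ℝ => volume {x : ℝ | (x, t - x) ∈ stdTriangle}) =
      (Set.Ioc (0 : ℝ) 1).indicator fun t => ENNReal.ofReal (0 + 1 * t) := by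
    ext t
    by_cases ht : t ∈ Set.Ioc (0 : ℝ) 1
    · rw [Set.indicator_of_mem ht]
      have : {x : ℝ | (x, t - x) ∈ stdTriangle} = Set.Icc 0 t := by
        ext x
        simp only [stdTriangle, Set.mem_ofPred_eq, Set.mem_Icc]
        exact ⟨fun h => ⟨h.1, by linarith [h.2.1]⟩, fun h => ⟨h.1, by linarith [h.2], by linarith [ht.2]⟩⟩
      rw [this, Real.volume_Icc]; congr 1; ring
    · rw [Set.indicator_of_notMem ht]
      refine measure_mono_null (t := {0}) (fun x hx => ?_) (by simp)
      obtain ⟨h1, h2, h3⟩ := hx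
      simp only at h1 h2 h3
      by_contra hx0
      exact ht ⟨(lt_of_le_of_ne h1 (Ne.symm hx0)).trans_le (by linarith), by linarith⟩
  rw [this, lintegral_indicator measurableSet_Ioc, lintegral_Ioc_linear zero_le_one
    fun t ht => by linarith [ht.1]]
  norm_num

theorem volume_biUnion_finset_le_of_card_le {A : Finset ℝ} {n : ℕ} (hA : A.card ≤ n) {s : ℝ}
    (I : ℝ → Set ℝ) (hI : ∀ a, volume (I a) = ENNReal.ofReal s) :
    volume (⋃ a ∈ A, I a) ≤ ENNReal.ofReal (n * s) := by
  refine (measure_biUnion_finset_le A I).trans ?_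
  simp_rw [hI]
  rw [Finset.sum_const, nsmul_eq_mul, ENNReal.ofReal_mul (by positivity), ENNReal.ofReal_natCast]
  gcongr

/-- A staircase inscribed in the triangle, having at most `2 * j` corners, has area at most
`j / (2 * j + 1)`. -/
theorem volume_staircase_le {j : ℕ} (hj : 0 < j) {L : AddSubgroup (ℝ × ℝ)} [Countable L]
    (hL : ∀ p q, {u | u ∈ L ∧ u ∈ Set.Icc p q}.Finite) (hS : staircase j L ⊆ stdTriangle) :
    volume (staircase j L) ≤ ENNReal.ofReal (j / (2 * j + 1)) := by
  obtain ⟨A, hA, hjump⟩ := exists_jumps hj hL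
  have hj0 : (0 : ℝ) < j := by exact_mod_cast hj
  -- the diagonal at which the bounds `t` and `2 * j * (1 - t)` agree
  set c : ℝ := 2 * j / (2 * j + 1) with hc
  have hc0 : 0 ≤ c := by positivity
  have hc1 : c ≤ 1 := by rw [hc, div_le_one (by positivity)]; linarith
  rw [volume_eq_lintegral_diagonal (measurableSet_staircase j L)]
  have hle : ∀ t : ℝ, volume {x : ℝ | (x, t - x) ∈ staircase j L} ≤
      (Set.Ioc 0 c).indicator (fun t => ENNReal.ofReal (0 + 1 * t)) t +
      (Set.Ioc c 1).indicator (fun t => ENNReal.ofReal (2 * j + -(2 * j) * t)) t := by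
    intro t
    have hIcc : volume {x : ℝ | (x, t - x) ∈ staircase j L} ≤ ENNReal.ofReal t := by
      refine (measure_mono (t := Set.Icc 0 t) fun x hx => ?_).trans (by simp)
      exact ⟨hx.1.1, by have := hx.1.2; simp at this; linarith⟩
    by_cases h1 : t ∈ Set.Ioc 0 c
    · rw [Set.indicator_of_mem h1]
      exact le_add_right (by simpa using hIcc)
    by_cases h2 : t ∈ Set.Ioc c 1
    · rw [Set.indicator_of_mem h2]
      refine le_add_left ((measure_mono (t := ⋃ a ∈ A, Set.Ico (a - (1 - t)) a) fun x hx => ?_).trans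
        ((volume_biUnion_finset_le_of_card_le hA (s := 1 - t) _ fun a => ?_).trans ?_))
      -- moving right from `x` by more than `1 - t` leaves the triangle, hence meets an edge
      · have hx0 : 0 ≤ x := hx.1.1
        have hout : (x + (1 - t) + 1, t - x) ∉ staircase j L := fun h => by
          have := (hS h).2.2
          simp only at this; linarith
        obtain ⟨a, haA, hxa, -, -, hin⟩ := hjump x _ _ hx0 (by linarith [h2.2]) hx hout
        refine Set.mem_biUnion haA ⟨?_, hxa⟩
        rw [sub_le_iff_le_add]
        refine le_of_forall_lt fun z hz => ?_
        rcases lt_or_ge z x with hzx | hzx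
        · linarith [h2.2]
        · obtain ⟨w, hzw, hwa⟩ := exists_between hz
          have := (hS (hin w (by linarith) hwa)).2.2
          simp only at this; linarith
      · rw [Real.volume_Ico]; congr 1; ring
      · apply le_of_eq; congr 1; push_cast; ring
    · rw [Set.indicator_of_notMem h1, Set.indicator_of_notMem h2, add_zero, nonpos_iff_eq_zero]
      rcases le_or_gt t 0 with ht | ht
      · exact le_antisymm (hIcc.trans (by simp [ht])) bot_le
      · convert measure_empty (μ := (volume : Measure ℝ))
        rw [Set.eq_empty_iff_forall_notMem]
        intro x hx
        have h3 := (hS hx).2.2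
        simp only at h3
        rcases le_or_gt t c with htc | htc
        · exact h1 ⟨ht, htc⟩
        · exact h2 ⟨htc, by linarith⟩
  refine (lintegral_mono hle).trans ?_
  rw [lintegral_add_left (Measurable.indicator (by fun_prop) measurableSet_Ioc),
    lintegral_indicator measurableSet_Ioc, lintegral_indicator measurableSet_Ioc,
    lintegral_Ioc_linear hc0 fun t ht => by linarith [ht.1],
    lintegral_Ioc_linear hc1 fun t ht => by nlinarith [ht.2],
    ← ENNReal.ofReal_add]
  · apply le_of_eq; congr 1; rw [hc]; field_simp; ring
  · have : 0 ≤ c ^ 2 := sq_nonneg c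
    linarith
  · nlinarith [sq_nonneg (1 - c)]

/-- A staircase circumscribed about the triangle, having at most `2 * j` corners, has area at least
`(2 * j + 1) / (4 * j)`. -/
theorem le_volume_staircase {j : ℕ} (hj : 0 < j) {L : AddSubgroup (ℝ × ℝ)} [Countable L]
    (hL : ∀ p q, {u | u ∈ L ∧ u ∈ Set.Icc p q}.Finite)
    (hS : stdTriangleInterior ⊆ staircase j L) :
    ENNReal.ofReal ((2 * j + 1) / (4 * j)) ≤ volume (staircase j L) := by
  obtain ⟨A, hA, hjump⟩ := exists_jumps hj hL
  have hj0 : (0 : ℝ) < j := by exact_mod_cast hj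
  -- the diagonal at which the bound `1 - 2 * j * (t - 1)` vanishes
  set c : ℝ := 1 + 1 / (2 * j) with hc
  have hc1 : 1 ≤ c := by rw [hc]; simp
  have hcj : 2 * j * (c - 1) = 1 := by rw [hc]; field_simp; ring
  rw [volume_eq_lintegral_diagonal (measurableSet_staircase j L)]
  have hle : ∀ t : ℝ, (Set.Ioc 0 1).indicator (fun t => ENNReal.ofReal (0 + 1 * t)) t +
      (Set.Ioc 1 c).indicator (fun t => ENNReal.ofReal ((1 + 2 * j) + -(2 * j) * t)) t ≤
      volume {x : ℝ | (x, t - x) ∈ staircase j L} := by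
    intro t
    by_cases h1 : t ∈ Set.Ioo 0 1
    · rw [Set.indicator_of_mem (show t ∈ Set.Ioc (0 : ℝ) 1 from ⟨h1.1, h1.2.le⟩),
        Set.indicator_of_notMem (fun h => by linarith [h.1, h1.2]),
        add_zero]
      refine le_trans ?_ (measure_mono (s := Set.Ioo 0 t) fun x hx => hS ⟨hx.1, ?_, ?_⟩)
      · simp
      · simp [hx.2]
      · simp [h1.2]
    by_cases h2 : t ∈ Set.Icc 1 c
    · have hbad : volume (⋃ a ∈ A, Set.Icc a (a + (t - 1))) ≤ ENNReal.ofReal ((2 * j : ℕ) * (t - 1)) :=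
        volume_biUnion_finset_le_of_card_le hA _ fun a => by rw [Real.volume_Icc]; congr 1; ring
      have hgood : ENNReal.ofReal ((1 + 2 * j) + -(2 * j) * t) ≤
          volume {x : ℝ | (x, t - x) ∈ staircase j L} := by
        refine le_trans ?_ (measure_mono
          (s := Set.Ioo (t - 1) t \ ⋃ a ∈ A, Set.Icc a (a + (t - 1))) fun x hx => ?_)
        · refine le_trans ?_ (le_measure_sdiff)
          rw [Real.volume_Ioo]
          refine le_trans (le_of_eq ?_) (tsub_le_tsub_left hbad _)
          rw [← ENNReal.ofReal_sub _ (mul_nonneg (by positivity) (by linarith [h2.1]))]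
          congr 1; push_cast; ring
        -- moving left from `x` by more than `t - 1` enters the triangle, hence meets an edge
        · by_contra hout
          obtain ⟨⟨hx1, hx2⟩, hxA⟩ := hx
          have hx0 : 0 < x - (t - 1) := by linarith
          have hin : ((x - (t - 1)) / 2, t - x) ∈ staircase j L :=
            hS ⟨by simp; linarith, by simp; linarith, by simp; linarith⟩
          obtain ⟨a, haA, hxa, hax, haS, -⟩ := hjump _ x _ (by linarith) (by linarith [h2.1]) hin hout
          refine hxA (Set.mem_biUnion haA ⟨hax, ?_⟩)
          by_contra! hlt
          exact haS (hS ⟨by simp only; linarith, by simp; linarith, by simp only; linarith⟩)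
      rcases h2.1.eq_or_lt with rfl | ht
      · simpa using hgood
      · rw [Set.indicator_of_notMem (fun h => by linarith [h.2]),
          Set.indicator_of_mem (show t ∈ Set.Ioc 1 c from ⟨ht, h2.2⟩),
          zero_add]
        exact hgood
    · rw [Set.indicator_of_notMem, Set.indicator_of_notMem]
      · simp
      · exact fun h => h2 ⟨h.1.le, h.2⟩
      · rintro ⟨h3, h4⟩
        rcases h4.eq_or_lt with rfl | h4
        · exact h2 ⟨le_rfl, hc1⟩
        · exact h1 ⟨h3, h4⟩
  refine le_trans ?_ (lintegral_mono hle)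
  rw [lintegral_add_left (Measurable.indicator (by fun_prop) measurableSet_Ioc),
    lintegral_indicator measurableSet_Ioc, lintegral_indicator measurableSet_Ioc,
    lintegral_Ioc_linear zero_le_one fun t ht => by linarith [ht.1],
    lintegral_Ioc_linear hc1 fun t ht => by nlinarith [ht.2],
    ← ENNReal.ofReal_add]
  · apply le_of_eq; congr 1; rw [hc]; field_simp; ring
  · norm_num
  · nlinarith [sq_nonneg (1 - c)]

/-! ### Densities and fundamental domains -/

theorem IsPlaneLattice.exists_isAddFundamentalDomain {Λ : Submodule ℤ Plane}
    (hΛ : IsPlaneLattice Λ) :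
    ∃ D : Set Plane, Bornology.IsBounded D ∧ IsAddFundamentalDomain Λ D volume := by
  obtain ⟨_, _⟩ := hΛ
  exact ⟨_, ZSpan.fundamentalDomain_isBounded _,
    ZLattice.isAddFundamentalDomain (Module.Free.chooseBasis ℤ Λ) volume⟩

theorem IsPlaneLattice.countable {Λ : Submodule ℤ Plane} (hΛ : IsPlaneLattice Λ) : Countable Λ := by
  obtain ⟨_, _⟩ := hΛ
  infer_instance

theorem IsPlaneLattice.finite_inter {Λ : Submodule ℤ Plane} (hΛ : IsPlaneLattice Λ) {s : Set Plane}
    (hs : Bornology.IsBounded s) : (s ∩ Λ).Finite := by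
  obtain ⟨_, _⟩ := hΛ
  have := ZSpan.setFinite_inter ((Module.Free.chooseBasis ℤ Λ).ofZLatticeBasis ℝ) hs
  rwa [(Module.Free.chooseBasis ℤ Λ).ofZLatticeBasis_span ℝ] at this

instance (Λ : Submodule ℤ Plane) : VAddInvariantMeasure Λ Plane volume :=
  inferInstanceAs (VAddInvariantMeasure Λ.toAddSubgroup Plane volume)

section FundamentalDomain

variable {Λ : Submodule ℤ Plane} [Countable Λ] {D : Set Plane}

/-- The area of `A` is the integral over a fundamental domain of the number of translates of `A`
that cover a point. -/
theorem volume_eq_lintegral_encard (hD : IsAddFundamentalDomain Λ D volume) {A : Set Plane}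
    (hA : MeasurableSet A) :
    volume A = ∫⁻ x in D, ({v : Λ | x ∈ latticeFamily A Λ v}.encard : ℝ≥0∞) := by
  have hm : ∀ v : Λ, MeasurableSet (latticeFamily A Λ v) := fun v => hA.const_vadd (v : Plane)
  rw [hD.measure_eq_tsum A]
  have h1 : ∀ v : Λ, volume ((v +ᵥ A) ∩ D) =
      ∫⁻ x in D, (latticeFamily A Λ v).indicator 1 x := fun v => by
    rw [lintegral_indicator_one (hm v), Measure.restrict_apply (hm v)]
    rfl
  simp_rw [h1]
  rw [← lintegral_tsum fun v => (measurable_one.indicator (hm v)).aemeasurable]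
  refine lintegral_congr fun x => ?_
  rw [← ENNReal.tsum_set_one, tsum_subtype {v : Λ | x ∈ latticeFamily A Λ v} fun _ => (1 : ℝ≥0∞)]
  rfl

theorem volume_le_of_encard_le (hD : IsAddFundamentalDomain Λ D volume) {A : Set Plane}
    (hA : MeasurableSet A) {n : ℕ} (h : ∀ x, {v : Λ | x ∈ latticeFamily A Λ v}.encard ≤ n) :
    volume A ≤ n * volume D := by
  rw [volume_eq_lintegral_encard hD hA, ← setLIntegral_const]
  exact lintegral_mono fun x => by simpa using ENat.toENNReal_le.2 (h x)

theorem le_volume_of_le_encard (hD : IsAddFundamentalDomain Λ D volume) {A : Set Plane}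
    (hA : MeasurableSet A) {n : ℕ} (h : ∀ x, n ≤ {v : Λ | x ∈ latticeFamily A Λ v}.encard) :
    n * volume D ≤ volume A := by
  rw [volume_eq_lintegral_encard hD hA, ← setLIntegral_const]
  exact lintegral_mono fun x => by simpa using ENat.toENNReal_le.2 (h x)

/-- The total area of a subfamily is proportional to the area of the union of the corresponding
translates of the fundamental domain. -/
theorem tsum_volume_latticeFamily (hD : IsAddFundamentalDomain Λ D volume) (h0 : volume D ≠ 0)
    (htop : volume D ≠ ⊤) (K : Set Plane) (I : Set Λ) :
    ∑' v : I, volume (latticeFamily K Λ v) =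
      volume K / volume D * volume (⋃ v : I, (v : Λ) +ᵥ D) := by
  rw [measure_iUnion₀ (fun (v w : I) hvw => hD.aedisjoint (Subtype.coe_injective.ne hvw))
    fun v => hD.nullMeasurableSet.vadd (v : Λ), ← ENNReal.tsum_mul_left]
  refine tsum_congr fun v => ?_
  have h1 : volume ((v : Λ) +ᵥ D) = volume D := measure_vadd volume ((v : Λ) : Plane) D
  rw [h1, ENNReal.div_mul_cancel h0 htop]
  exact measure_vadd volume ((v : Λ) : Plane) K

theorem volume_square (l : ℝ) : volume (square l) = ENNReal.ofReal (2 * l) ^ 2 := by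
  have : square l = (WithLp.ofLp : Plane → (Fin 2 → ℝ)) ⁻¹' Set.Icc (fun _ => -l) (fun _ => l) := by
    ext x
    simp only [square, Set.mem_ofPred_eq, Set.mem_preimage, Set.mem_Icc, Pi.le_def]
    exact forall_and
  rw [this, (PiLp.volume_preserving_ofLp (Fin 2)).measure_preimage
      measurableSet_Icc.nullMeasurableSet,
    Real.volume_Icc_pi]
  simp [two_mul, sq]

theorem Plane.abs_apply_le_norm (x : Plane) (i : Fin 2) : |x i| ≤ ‖x‖ := by
  simpa using PiLp.norm_apply_le x i

/-- The translates of `D` that belong to the members meeting the square of half-side `l` lie in the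
square of half-side `l + r`. -/
theorem upperDensityIn_le (hD : IsAddFundamentalDomain Λ D volume) (h0 : volume D ≠ 0)
    (htop : volume D ≠ ⊤) {K : Set Plane} {r : ℝ} (hKD : ∀ x ∈ K, ∀ y ∈ D, ‖x - y‖ ≤ r) (l : ℝ) :
    upperDensityIn (latticeFamily K Λ) (square l) ≤
      volume K / volume D * (volume (square (l + r)) / volume (square l)) := by
  rw [upperDensityIn, ← mul_div_assoc]
  refine ENNReal.div_le_div_right ((tsum_volume_latticeFamily hD h0 htop K
    {v : Λ | (latticeFamily K Λ v ∩ square l).Nonempty}).le.trans ?_) _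
  gcongr
  refine Set.iUnion_subset ?_
  rintro ⟨v, _, ⟨k, hk, rfl⟩, hl⟩ _ ⟨d, hd, rfl⟩ i
  have h1 := hl i
  have h2 := abs_le.1 ((Plane.abs_apply_le_norm _ i).trans (hKD k hk d hd))
  change (v : Plane) i + k i ∈ _ at h1
  change (v : Plane) i + d i ∈ _
  simp only [PiLp.sub_apply, Set.mem_Icc] at h1 h2 ⊢
  constructor <;> linarith [h1.1, h1.2, h2.1, h2.2]

/-- The translates of `D` that belong to the members inside the square of half-side `l` cover almost
all of the square of half-side `l - r`. -/
theorem le_lowerDensityIn (hD : IsAddFundamentalDomain Λ D volume) (h0 : volume D ≠ 0)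
    (htop : volume D ≠ ⊤) {K : Set Plane} {r : ℝ} (hKD : ∀ x ∈ K, ∀ y ∈ D, ‖x - y‖ ≤ r) (l : ℝ) :
    volume K / volume D * (volume (square (l - r)) / volume (square l)) ≤
      lowerDensityIn (latticeFamily K Λ) (square l) := by
  rw [lowerDensityIn, ← mul_div_assoc]
  refine ENNReal.div_le_div_right (le_trans ?_ (tsum_volume_latticeFamily hD h0 htop K
    {v : Λ | latticeFamily K Λ v ⊆ square l}).ge) _
  refine mul_le_mul' le_rfl (measure_mono_ae ?_)
  filter_upwards [eventuallyEq_univ.1 hD.iUnion_vadd_ae_eq] with x hx hxl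
  obtain ⟨v, hv⟩ := Set.mem_iUnion.1 hx
  refine Set.mem_iUnion.2 ⟨⟨v, ?_⟩, hv⟩
  obtain ⟨d, hd, rfl⟩ := hv
  rintro _ ⟨k, hk, rfl⟩ i
  have h1 := hxl i
  have h2 := abs_le.1 ((Plane.abs_apply_le_norm _ i).trans (hKD k hk d hd))
  change (v : Plane) i + d i ∈ _ at h1
  change (v : Plane) i + k i ∈ _
  simp only [PiLp.sub_apply, Set.mem_Icc] at h1 h2 ⊢
  constructor <;> linarith [h1.1, h1.2, h2.1, h2.2]

theorem tendsto_volume_square_div (r : ℝ) :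
    Tendsto (fun l : ℝ => volume (square (l + r)) / volume (square l)) atTop (nhds 1) := by
  have h1 : Tendsto (fun l : ℝ => ENNReal.ofReal ((1 + r * l⁻¹) ^ 2)) atTop (nhds 1) := by
    have h2 : Tendsto (fun l : ℝ => (1 + r * l⁻¹) ^ 2) atTop (nhds ((1 + r * 0) ^ 2)) :=
      ((tendsto_inv_atTop_zero.const_mul r).const_add 1).pow 2
    simpa using ENNReal.tendsto_ofReal h2
  refine h1.congr' ?_
  filter_upwards [eventually_gt_atTop 0, eventually_ge_atTop (-r)] with l hl hr
  rw [volume_square, volume_square, ← ENNReal.ofReal_pow (by linarith),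
    ← ENNReal.ofReal_pow (by linarith), ← ENNReal.ofReal_div_of_pos (by positivity)]
  congr 1
  field_simp

/-- Both densities of the lattice family of a bounded nonempty set are limits, equal to the area of
the set divided by that of a fundamental domain. -/
theorem tendsto_densityIn (hD : IsAddFundamentalDomain Λ D volume) (hDb : Bornology.IsBounded D)
    {K : Set Plane} (hK : Bornology.IsBounded K) (hne : K.Nonempty) :
    Tendsto (fun l => upperDensityIn (latticeFamily K Λ) (square l)) atTop
        (nhds (volume K / volume D)) ∧
      Tendsto (fun l => lowerDensityIn (latticeFamily K Λ) (square l)) atTop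
        (nhds (volume K / volume D)) := by
  have h0 : volume D ≠ 0 := hD.measure_ne_zero (NeZero.ne _)
  have htop : volume D ≠ ⊤ := hDb.measure_lt_top.ne
  obtain ⟨r₁, h₁⟩ := hK.exists_norm_le
  obtain ⟨r₂, h₂⟩ := hDb.exists_norm_le
  have hKD : ∀ x ∈ K, ∀ y ∈ D, ‖x - y‖ ≤ r₁ + r₂ := fun x hx y hy =>
    (norm_sub_le x y).trans (add_le_add (h₁ x hx) (h₂ y hy))
  have hle : ∀ l, lowerDensityIn (latticeFamily K Λ) (square l) ≤
      upperDensityIn (latticeFamily K Λ) (square l) := fun l => by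
    refine ENNReal.div_le_div_right (ENNReal.tsum_mono_subtype
      (fun v => volume (latticeFamily K Λ v)) fun v hv => ?_) _
    have hvne : (latticeFamily K Λ v).Nonempty := hne.vadd_set
    change (latticeFamily K Λ v ∩ square l).Nonempty
    rwa [Set.inter_eq_left.2 hv]
  have hlim : ∀ r, Tendsto (fun l : ℝ => volume K / volume D *
      (volume (square (l + r)) / volume (square l))) atTop (nhds (volume K / volume D)) := fun r => by
    simpa using ENNReal.Tendsto.const_mul (tendsto_volume_square_div r)
      (Or.inl one_ne_zero) (a := volume K / volume D)
  have hlo := hlim (-(r₁ + r₂))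
  simp only [← sub_eq_add_neg] at hlo
  have hup := hlim (r₁ + r₂)
  exact ⟨tendsto_of_tendsto_of_tendsto_of_le_of_le hlo hup
      (fun l => (le_lowerDensityIn hD h0 htop hKD l).trans (hle l))
      (upperDensityIn_le hD h0 htop hKD),
    tendsto_of_tendsto_of_tendsto_of_le_of_le hlo hup (le_lowerDensityIn hD h0 htop hKD)
      (fun l => (hle l).trans (upperDensityIn_le hD h0 htop hKD l))⟩

end FundamentalDomain

/-! ### Coordinates adapted to a triangle -/

theorem ContinuousLinearEquiv.exists_volume_preimage (e : Plane ≃L[ℝ] ℝ × ℝ) :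
    ∃ c : ℝ≥0∞, c ≠ 0 ∧ c ≠ ⊤ ∧ ∀ A : Set (ℝ × ℝ), MeasurableSet A →
      volume (e ⁻¹' A) = c * volume A := by
  have := e.isAddHaarMeasure_map (volume : Measure Plane)
  refine ⟨Measure.addHaarScalarFactor (volume.map e) (volume : Measure (ℝ × ℝ)), ?_,
    ENNReal.coe_ne_top, fun A hA => ?_⟩
  · exact ENNReal.coe_ne_zero.2 (Measure.addHaarScalarFactor_pos_of_isAddHaarMeasure _ _).ne'
  rw [← Measure.map_apply e.continuous.measurable hA]
  exact congrArg (· A) (Measure.isAddLeftInvariant_eq_smul (volume.map e)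
    (volume : Measure (ℝ × ℝ)))

/-- The barycentric coordinates with respect to the second and third vertices, made linear by taking
the first vertex as origin `o`. -/
theorem exists_triangle_coordinates (T : Affine.Triangle ℝ Plane) :
    ∃ (e : Plane ≃L[ℝ] ℝ × ℝ) (o : Plane),
      convexHull ℝ (Set.range T.points) = {x | e (x - o) ∈ stdTriangle} ∧
      interior (convexHull ℝ (Set.range T.points)) = {x | e (x - o) ∈ stdTriangleInterior} := by
  have htop : affineSpan ℝ (Set.range T.points) = ⊤ := by
    rw [T.independent.affineSpan_eq_top_iff_card_eq_finrank_add_one]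
    simp
  let b : AffineBasis (Fin 3) ℝ Plane := ⟨T.points, T.independent, htop⟩
  let f : Plane →ₗ[ℝ] ℝ × ℝ := (b.coord 1).linear.prod (b.coord 2).linear
  have h1 : ∀ x, (b.coord 1).linear (x - b 0) = b.coord 1 x := fun x => by
    have := (b.coord 1).linearMap_vsub x (b 0)
    simpa using this
  have h2 : ∀ x, (b.coord 2).linear (x - b 0) = b.coord 2 x := fun x => by
    have := (b.coord 2).linearMap_vsub x (b 0)
    simpa using this
  have h0 : ∀ x, b.coord 0 x + b.coord 1 x + b.coord 2 x = 1 := fun x => by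
    have := b.sum_coord_apply_eq_one x
    rwa [Fin.sum_univ_three] at this
  have hf : ∀ x, f (x - b 0) = (b.coord 1 x, b.coord 2 x) := fun x => by
    rw [← h1, ← h2]; rfl
  have hinj : Function.Injective f := by
    rw [injective_iff_map_eq_zero]
    intro v hv
    have h3 := hf (v + b 0)
    rw [add_sub_cancel_right, hv, Prod.ext_iff] at h3
    have h4 : v + b 0 = b 0 := by
      refine b.ext_elem fun i => ?_
      have h5 := h0 (v + b 0)
      fin_cases i
      · simp at h3 ⊢; linarith [h3.1, h3.2]
      · simpa using h3.1.symm
      · simpa using h3.2.symm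
    simpa using h4
  let e := (LinearEquiv.ofInjectiveOfFinrankEq f hinj (by simp)).toContinuousLinearEquiv
  have he : ∀ x, e (x - b 0) = (b.coord 1 x, b.coord 2 x) := hf
  refine ⟨e, b 0, ?_, ?_⟩
  · change convexHull ℝ (Set.range b) = _
    rw [b.convexHull_eq_nonneg_coord]
    ext x
    have := h0 x
    simp only [Set.mem_ofPred_eq, he, stdTriangle, Fin.forall_fin_succ, Fin.isValue,
      Fin.succ_zero_eq_one, Fin.succ_one_eq_two, IsEmpty.forall_iff, and_true]
    constructor
    · rintro ⟨a, b, c⟩; exact ⟨b, c, by linarith⟩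
    · rintro ⟨b, c, a⟩; exact ⟨by linarith, b, c⟩
  · change interior (convexHull ℝ (Set.range b)) = _
    rw [b.interior_convexHull]
    ext x
    have := h0 x
    simp only [Set.mem_ofPred_eq, he, stdTriangleInterior, Fin.forall_fin_succ, Fin.isValue,
      Fin.succ_zero_eq_one, Fin.succ_one_eq_two, IsEmpty.forall_iff, and_true]
    constructor
    · rintro ⟨a, b, c⟩; exact ⟨b, c, by linarith⟩
    · rintro ⟨b, c, a⟩; exact ⟨by linarith, b, c⟩

/-! ### An extremal lattice and its staircase tile -/

/-- The lower left corners of the unit cells of the staircase `r, q ≥ 0`, `r + q < 2 * j`, in a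
given class of `r - q` modulo `2 * j + 1`. -/
def stairCells (j : ℕ) (τ : ℤ) : Set (ℤ × ℤ) :=
  {s | 0 ≤ s.1 ∧ 0 ≤ s.2 ∧ s.1 + s.2 < 2 * j ∧ (2 * j + 1 : ℤ) ∣ s.1 - s.2 - τ}

/-- For each `n`, exactly one of the diagonals `r + q = n` and `r + q = 2 * j - 1 - n` contains a
cell of the given class, and it contains only one. Hence `(r, q) ↦ min n (2 * j - 1 - n)`, with `n = r + q`,
is a bijection onto the integers from `0` to `j - 1`. -/
theorem encard_stairCells (j : ℕ) (τ : ℤ) : (stairCells j τ).encard = j := by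
  have hcard : (Set.Ico (0 : ℤ) j).encard = j := by
    rw [← Finset.coe_Ico, Set.encard_coe_eq_coe_finsetCard, Int.card_Ico]
    simp
  set f : ℤ × ℤ → ℤ := fun s => min (s.1 + s.2) (2 * j - 1 - (s.1 + s.2)) with hf
  apply le_antisymm
  · rw [← hcard]
    refine Set.encard_le_encard_of_injOn (f := f) ?_ ?_
    · rintro ⟨r, q⟩ ⟨h1, h2, h3, -⟩
      simp only [hf, Set.mem_Ico] at *
      omega
    · rintro ⟨r, q⟩ ⟨h1, h2, h3, h4⟩ ⟨r', q'⟩ ⟨h1', h2', h3', h4'⟩ h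
      simp only [hf] at h h1 h2 h3 h4 h1' h2' h3' h4'
      have hd := dvd_sub h4 h4'
      rcases (by omega : r + q = r' + q' ∨ r + q + (r' + q') = 2 * j - 1) with hs | hs
      · have h5 : (2 * j + 1 : ℤ) ∣ r - r' := by
          have e1 : r - r' = (j + 1) * (r - q - τ - (r' - q' - τ)) - (2 * j + 1) * (r - r') := by
            have : q = r' + q' - r := by linarith
            subst this; ring
          rw [e1]
          exact dvd_sub (hd.mul_left _) (dvd_mul_right _ _)
        have h6 := Int.eq_zero_of_abs_lt_dvd h5 (abs_lt.2 ⟨by omega, by omega⟩)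
        rw [Prod.mk.injEq]; omega
      -- otherwise `r + q'` and `r' + q` are congruent, hence equal, and their sum is odd
      · have h6 := Int.eq_zero_of_abs_lt_dvd hd (abs_lt.2 ⟨by omega, by omega⟩)
        omega
  · rw [← hcard]
    refine (Set.encard_le_encard fun i hi => ?_).trans (Set.encard_image_le f _)
    obtain ⟨hi0, hij⟩ := hi
    -- `r` solves `2 r ≡ i + τ` modulo `2 j + 1`
    set r : ℤ := (j + 1) * (i + τ) % (2 * j + 1) with hr
    have hr0 : 0 ≤ r := Int.emod_nonneg _ (by omega)
    have hrj : r < 2 * j + 1 := Int.emod_lt_of_pos _ (by omega)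
    have hdvd : (2 * j + 1 : ℤ) ∣ 2 * r - i - τ := by
      have e1 := Int.emod_add_mul_ediv ((j + 1) * (i + τ)) (2 * j + 1)
      rw [← hr] at e1
      refine ⟨(i + τ) - 2 * ((j + 1) * (i + τ) / (2 * j + 1)), ?_⟩
      linear_combination 2 * e1
    rcases le_or_gt r i with hri | hri
    · refine ⟨(r, i - r), ⟨hr0, by simp only; omega, by simp only; omega, ?_⟩, ?_⟩
      · convert! hdvd using 1; simp only; ring
      · simp only [hf]; omega
    · refine ⟨(r - 1 - i, 2 * j - r), ⟨by simp only; omega, by simp only; omega,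
        by simp only; omega, ?_⟩, ?_⟩
      · have := dvd_sub hdvd (dvd_refl (2 * j + 1 : ℤ))
        convert! this using 1; simp only; ring
      · simp only [hf]; omega

/-- The lattice `{(a, b) ∈ ℤ² | a ≡ b mod 2 * j + 1}` scaled by `1 / N`. -/
def congruenceLattice (j : ℕ) (N : ℝ) : Set (ℝ × ℝ) :=
  {u | ∃ a b : ℤ, (2 * j + 1 : ℤ) ∣ b - a ∧ u = (a / N, b / N)}

theorem encard_congruenceLattice_packing {j : ℕ} (hj : 0 < j) (p : ℝ × ℝ) :
    {u | u ∈ congruenceLattice j (2 * j) ∧ p - u ∈ stdTriangleInterior}.encard ≤ j := by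
  have hN : (0 : ℝ) < 2 * j := by positivity
  set N : ℝ := 2 * j with hNdef
  set A := ⌊N * p.1⌋ with hA
  set B := ⌊N * p.2⌋ with hB
  rw [← encard_stairCells j (A - B)]
  refine (Set.encard_le_encard ?_).trans (Set.encard_image_le
    (fun s : ℤ × ℤ => (((A - s.1 : ℤ) / N, (B - s.2 : ℤ) / N) : ℝ × ℝ)) _)
  rintro _ ⟨⟨a, b, hab, rfl⟩, h1, h2, h3⟩
  simp only [Prod.fst_sub, Prod.snd_sub] at h1 h2 h3
  have e1 : (a : ℝ) < N * p.1 := by rw [sub_pos, div_lt_iff₀ hN] at h1; linarith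
  have e2 : (b : ℝ) < N * p.2 := by rw [sub_pos, div_lt_iff₀ hN] at h2; linarith
  have e3 : N * p.1 + N * p.2 < a + b + N := by
    have : (p.1 + p.2) < (a + b + N) / N := by
      rw [add_div, add_div, div_self hN.ne']; linarith
    rw [lt_div_iff₀ hN] at this; linarith
  have i1 : a ≤ A := Int.le_floor.2 e1.le
  have i2 : b ≤ B := Int.le_floor.2 e2.le
  have i3 : A + B < a + b + 2 * j := by
    have : (A : ℝ) + B < a + b + 2 * j := by
      linarith [Int.floor_le (N * p.1), Int.floor_le (N * p.2)]
    exact_mod_cast this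
  refine ⟨(A - a, B - b), ⟨by simp only; omega, by simp only; omega, by simp only; omega, ?_⟩, ?_⟩
  · convert! hab using 1; simp only; ring
  · simp

theorem encard_congruenceLattice_covering {j : ℕ} (p : ℝ × ℝ) :
    j ≤ {u | u ∈ congruenceLattice j (2 * j + 1) ∧ p - u ∈ stdTriangle}.encard := by
  have hN : (0 : ℝ) < 2 * j + 1 := by positivity
  set N : ℝ := 2 * j + 1 with hNdef
  set A := ⌊N * p.1⌋ with hA
  set B := ⌊N * p.2⌋ with hB
  have hinj : Function.Injective
      (fun s : ℤ × ℤ => (((A - s.1 : ℤ) / N, (B - s.2 : ℤ) / N) : ℝ × ℝ)) := by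
    rintro ⟨r, q⟩ ⟨r', q'⟩ h
    simp only [Prod.mk.injEq, div_left_inj' hN.ne', Int.cast_inj, sub_right_inj] at h
    rw [h.1, h.2]
  rw [← encard_stairCells j (A - B), ← hinj.encard_image]
  refine Set.encard_le_encard ?_
  rintro _ ⟨⟨r, q⟩, ⟨h1, h2, h3, h4⟩, rfl⟩
  simp only at h1 h2 h3 h4
  refine ⟨⟨A - r, B - q, ?_, rfl⟩, ?_⟩
  · convert! h4 using 1; ring
  have i1 : (0 : ℝ) ≤ r := by exact_mod_cast h1
  have i2 : (0 : ℝ) ≤ q := by exact_mod_cast h2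
  have i3 : (r : ℝ) + q + 1 ≤ 2 * j := by exact_mod_cast Int.add_one_le_of_lt h3
  have hA1 := Int.floor_le (N * p.1)
  have hA2 := Int.lt_floor_add_one (N * p.1)
  have hB1 := Int.floor_le (N * p.2)
  have hB2 := Int.lt_floor_add_one (N * p.2)
  refine ⟨?_, ?_, ?_⟩ <;> simp only [Prod.fst_sub, Prod.snd_sub, Int.cast_sub]
  · rw [sub_nonneg, div_le_iff₀ hN]; linarith
  · rw [sub_nonneg, div_le_iff₀ hN]; linarith
  · have : p.1 + p.2 ≤ (A - r + (B - q) + N) / N := by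
      rw [le_div_iff₀ hN]; linarith
    rw [add_div, add_div, div_self hN.ne'] at this
    linarith

/-! ### Lattices in coordinates -/

/-- The lattice `Λ` in the coordinates given by `e`. -/
def coordLattice (e : Plane ≃L[ℝ] ℝ × ℝ) (Λ : Submodule ℤ Plane) : AddSubgroup (ℝ × ℝ) :=
  Λ.toAddSubgroup.map (e : Plane →+ ℝ × ℝ)

/-- The number of members of the family that contain `x`, counted in coordinates. -/
theorem encard_latticeFamily_coord (e : Plane ≃L[ℝ] ℝ × ℝ) (o : Plane) (A : Set (ℝ × ℝ))
    (Λ : Submodule ℤ Plane) (x : Plane) :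
    {v : Λ | x ∈ latticeFamily {y | e (y - o) ∈ A} Λ v}.encard =
      {u | u ∈ coordLattice e Λ ∧ e (x - o) - u ∈ A}.encard := by
  have hinj : Function.Injective fun v : Λ => e v := e.injective.comp Subtype.val_injective
  rw [← hinj.encard_image]
  congr 1
  have hmem : ∀ v : Λ, x ∈ latticeFamily {y | e (y - o) ∈ A} Λ v ↔ e (x - o) - e v ∈ A := fun v => by
    rw [latticeFamily, Set.mem_vadd_set_iff_neg_vadd_mem, ← map_sub, Set.mem_ofPred_eq, vadd_eq_add]
    rw [show -(v : Plane) + x - o = x - o - v by abel]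
  ext u
  constructor
  · rintro ⟨v, hv, rfl⟩
    exact ⟨⟨v, v.2, rfl⟩, (hmem v).1 hv⟩
  · rintro ⟨⟨v, hv, rfl⟩, hu⟩
    exact ⟨⟨v, hv⟩, (hmem ⟨v, hv⟩).2 hu, rfl⟩

theorem coordLattice_finite_inter_Icc (e : Plane ≃L[ℝ] ℝ × ℝ) {Λ : Submodule ℤ Plane}
    (hΛ : IsPlaneLattice Λ) (p q : ℝ × ℝ) :
    {u | u ∈ coordLattice e Λ ∧ u ∈ Set.Icc p q}.Finite := by
  have hb : Bornology.IsBounded (e.symm '' Set.Icc p q) :=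
    (isCompact_Icc.image e.symm.continuous).isBounded
  refine ((hΛ.finite_inter hb).image e).subset ?_
  rintro _ ⟨⟨v, hv, rfl⟩, hu⟩
  exact ⟨v, ⟨⟨e v, hu, e.symm_apply_apply v⟩, hv⟩, rfl⟩

instance (e : Plane ≃L[ℝ] ℝ × ℝ) (Λ : Submodule ℤ Plane) [Countable Λ] :
    Countable (coordLattice e Λ) := by
  have : (Λ : Set Plane).Countable := Set.countable_coe_iff.1 ‹_›
  exact (this.image e).to_subtype

/-- Every `congruenceLattice j N` with `N > 0` is, in the coordinates `e`, a lattice whose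
fundamental domain has area `(2 * j + 1) / N ^ 2` in units of `c`, the area of the parallelogram of
points with coordinates in `[0, 1)`. -/
theorem exists_lattice_coord_eq_congruenceLattice (e : Plane ≃L[ℝ] ℝ × ℝ) {c : ℝ≥0∞}
    (hc : ∀ A : Set (ℝ × ℝ), MeasurableSet A → volume (e ⁻¹' A) = c * volume A) (j : ℕ) {N : ℝ}
    (hN : 0 < N) :
    ∃ (Λ : Submodule ℤ Plane) (D : Set Plane), IsPlaneLattice Λ ∧ Bornology.IsBounded D ∧
      IsAddFundamentalDomain Λ D volume ∧
      volume D = ENNReal.ofReal ((2 * j + 1) / N ^ 2) * c ∧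
      (coordLattice e Λ : Set (ℝ × ℝ)) = congruenceLattice j N := by
  have hm : (0 : ℝ) < 2 * j + 1 := by positivity
  set w : Fin 2 → Plane := ![e.symm (1 / N, 1 / N), e.symm (0, (2 * j + 1) / N)] with hw
  have hli : LinearIndependent ℝ w := by
    rw [hw, LinearIndependent.pair_iff]
    intro s t h
    have h' := congrArg e h
    simp only [map_add, map_smul, e.apply_symm_apply, map_zero, Prod.ext_iff, Prod.fst_add,
      Prod.snd_add, Prod.smul_fst, Prod.smul_snd, smul_eq_mul, Prod.fst_zero, Prod.snd_zero] at h'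
    obtain ⟨h1, h2⟩ := h'
    have hs : s = 0 := by
      have : s * (1 / N) = 0 := by linarith
      exact (mul_eq_zero.1 this).resolve_right (by positivity)
    subst hs
    have : t * ((2 * j + 1) / N) = 0 := by linarith
    exact ⟨rfl, (mul_eq_zero.1 this).resolve_right (by positivity)⟩
  let b := basisOfLinearIndependentOfCardEqFinrank hli (by simp)
  have hb : (b : Fin 2 → Plane) = w := coe_basisOfLinearIndependentOfCardEqFinrank hli _
  let b₀ : Module.Basis (Fin 2) ℝ Plane := (Module.Basis.finTwoProd ℝ).map e.symm.toLinearEquiv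
  refine ⟨Submodule.span ℤ (Set.range b), ZSpan.fundamentalDomain b, ⟨inferInstance, inferInstance⟩,
    ZSpan.fundamentalDomain_isBounded b, ZSpan.isAddFundamentalDomain b volume, ?_, ?_⟩
  · rw [ZSpan.measure_fundamentalDomain b volume b₀]
    have hb₀ : ZSpan.fundamentalDomain b₀ = e ⁻¹' (Set.Ico 0 1 ×ˢ Set.Ico 0 1) := by
      ext x
      simp [ZSpan.mem_fundamentalDomain, b₀, Fin.forall_fin_two, Set.mem_prod]
    have hdet : b₀.det b = (2 * j + 1) / N ^ 2 := by
      rw [Module.Basis.det_apply, Matrix.det_fin_two]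
      simp only [Module.Basis.toMatrix_apply, hb, hw, b₀]
      simp
      field_simp
    rw [hb₀, hc _ (measurableSet_Ico.prod measurableSet_Ico), hdet, abs_of_nonneg (by positivity),
      Measure.volume_eq_prod, Measure.prod_prod]
    simp
  · ext u
    have hrange : Set.range b = {e.symm (1 / N, 1 / N), e.symm (0, (2 * j + 1) / N)} := by
      rw [hb, hw, Matrix.range_cons_cons_empty]
    have hmem : ∀ v, v ∈ Submodule.span ℤ (Set.range b) ↔
        ∃ s t : ℤ, e v = (s / N, (s + (2 * j + 1) * t) / N) := fun v => by
      rw [hrange, Submodule.mem_span_pair]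
      refine exists_congr fun s => exists_congr fun t => ?_
      rw [← e.injective.eq_iff, map_add, map_zsmul, map_zsmul, e.apply_symm_apply,
        e.apply_symm_apply, eq_comm]
      refine Eq.congr rfl ?_
      ext <;> simp <;> ring
    constructor
    · rintro ⟨v, hv, rfl⟩
      obtain ⟨s, t, hst⟩ := (hmem v).1 hv
      refine ⟨s, s + (2 * j + 1) * t, by simp, ?_⟩
      push_cast
      exact hst
    · rintro ⟨a, d, ⟨t, ht⟩, rfl⟩
      refine ⟨e.symm (a / N, d / N), (hmem _).2 ⟨a, t, ?_⟩, e.apply_symm_apply _⟩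
      rw [e.apply_symm_apply, show d = a + (2 * j + 1) * t by linarith]
      push_cast
      rfl

/-! ### The bounds on the area of a fundamental domain -/

theorem le_volume_of_packing (e : Plane ≃L[ℝ] ℝ × ℝ) {c : ℝ≥0∞}
    (hc : ∀ A : Set (ℝ × ℝ), MeasurableSet A → volume (e ⁻¹' A) = c * volume A) {j : ℕ} (hj : 0 < j)
    {Λ : Submodule ℤ Plane} (hΛ : IsPlaneLattice Λ) {D : Set Plane}
    (hD : IsAddFundamentalDomain Λ D volume)
    (h : ∀ p, {u | u ∈ coordLattice e Λ ∧ p - u ∈ stdTriangleInterior}.encard ≤ j) :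
    c * ENNReal.ofReal ((2 * j + 1) / (4 * j)) ≤ j * volume D := by
  have := hΛ.countable
  have hm := measurableSet_staircase j (coordLattice e Λ)
  calc c * ENNReal.ofReal ((2 * j + 1) / (4 * j))
      ≤ c * volume (staircase j (coordLattice e Λ)) := by
        gcongr
        exact le_volume_staircase hj (coordLattice_finite_inter_Icc e hΛ)
          (subset_staircase_of_packing h)
    _ = volume (e ⁻¹' staircase j (coordLattice e Λ)) := (hc _ hm).symm
    _ ≤ j * volume D := volume_le_of_encard_le hD (e.continuous.measurable hm) fun x => by
        have h1 := encard_latticeFamily_coord e 0 (staircase j (coordLattice e Λ)) Λ x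
        simp only [sub_zero] at h1
        exact h1.trans_le (encard_staircase_translates_le j _ _)

theorem volume_le_of_covering (e : Plane ≃L[ℝ] ℝ × ℝ) {c : ℝ≥0∞}
    (hc : ∀ A : Set (ℝ × ℝ), MeasurableSet A → volume (e ⁻¹' A) = c * volume A) {j : ℕ} (hj : 0 < j)
    {Λ : Submodule ℤ Plane} (hΛ : IsPlaneLattice Λ) {D : Set Plane}
    (hD : IsAddFundamentalDomain Λ D volume)
    (h : ∀ p, (j : ℕ∞) ≤ {u | u ∈ coordLattice e Λ ∧ p - u ∈ stdTriangle}.encard) :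
    j * volume D ≤ c * ENNReal.ofReal (j / (2 * j + 1)) := by
  have := hΛ.countable
  have hm := measurableSet_staircase j (coordLattice e Λ)
  have hfin := coordLattice_finite_inter_Icc e hΛ
  calc j * volume D ≤ volume (e ⁻¹' staircase j (coordLattice e Λ)) :=
        le_volume_of_le_encard hD (e.continuous.measurable hm) fun x => by
          have h1 := encard_latticeFamily_coord e 0 (staircase j (coordLattice e Λ)) Λ x
          simp only [sub_zero] at h1
          refine (le_encard_staircase_translates hfin ?_).trans_eq h1.symm
          exact (h (e x)).trans (Set.encard_le_encard fun u hu => ⟨hu.1, hu.2.1, hu.2.2.1⟩)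
    _ = c * volume (staircase j (coordLattice e Λ)) := hc _ hm
    _ ≤ c * ENNReal.ofReal (j / (2 * j + 1)) := by
        gcongr
        exact volume_staircase_le hj hfin (staircase_subset_of_covering h)

theorem IsPlaneLattice.exists_density_eq {Λ : Submodule ℤ Plane} (hΛ : IsPlaneLattice Λ)
    {K : Set Plane} (hK : Bornology.IsBounded K) (hne : K.Nonempty) :
    ∃ D : Set Plane, IsAddFundamentalDomain Λ D volume ∧ volume D ≠ 0 ∧ volume D ≠ ⊤ ∧
      upperDensity (latticeFamily K Λ) = volume K / volume D ∧
      lowerDensity (latticeFamily K Λ) = volume K / volume D := by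
  have := hΛ.countable
  obtain ⟨D, hDb, hD⟩ := hΛ.exists_isAddFundamentalDomain
  obtain ⟨hu, hl⟩ := tendsto_densityIn hD hDb hK hne
  exact ⟨D, hD, hD.measure_ne_zero (NeZero.ne _), hDb.measure_lt_top.ne, hu.limsup_eq, hl.liminf_eq⟩

/-! ### Packings and coverings in coordinates -/

theorem isMultiplePacking_iff_coord (e : Plane ≃L[ℝ] ℝ × ℝ) (o : Plane) {K : Set Plane}
    {A : Set (ℝ × ℝ)} (hK : interior K = {x | e (x - o) ∈ A}) (j : ℕ) (Λ : Submodule ℤ Plane) :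
    IsMultiplePacking j (latticeFamily K Λ) Set.univ ↔
      ∀ p, {u | u ∈ coordLattice e Λ ∧ p - u ∈ A}.encard ≤ j := by
  have h1 : ∀ x, {v : Λ | x ∈ interior (latticeFamily K Λ v)}.encard =
      {u | u ∈ coordLattice e Λ ∧ e (x - o) - u ∈ A}.encard := fun x => by
    simp only [latticeFamily, interior_vadd, hK]
    exact encard_latticeFamily_coord e o A Λ x
  simp only [IsMultiplePacking, Set.subset_univ, true_and, Set.mem_univ, true_imp_iff, h1]
  refine ⟨fun h p => ?_, fun h x => h _⟩
  simpa using h (e.symm p + o)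

theorem isMultipleCovering_iff_coord (e : Plane ≃L[ℝ] ℝ × ℝ) (o : Plane) {K : Set Plane}
    {A : Set (ℝ × ℝ)} (hK : K = {x | e (x - o) ∈ A}) (j : ℕ) (Λ : Submodule ℤ Plane) :
    IsMultipleCovering j (latticeFamily K Λ) Set.univ ↔
      ∀ p, (j : ℕ∞) ≤ {u | u ∈ coordLattice e Λ ∧ p - u ∈ A}.encard := by
  subst hK
  simp only [IsMultipleCovering, Set.mem_univ, true_imp_iff, encard_latticeFamily_coord]
  refine ⟨fun h p => ?_, fun h x => h _⟩
  simpa using h (e.symm p + o)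

/-! ### The packing and covering densities of a triangle -/

theorem theorem1 (T : Affine.Triangle ℝ Plane) (j : ℕ) (hj : 0 < j) :
    latticePackingDensity j (convexHull ℝ (Set.range T.points)) =
        ENNReal.ofReal (2 * (j : ℝ) ^ 2 / (2 * (j : ℝ) + 1)) ∧
      latticeCoveringDensity j (convexHull ℝ (Set.range T.points)) =
        ENNReal.ofReal ((2 * (j : ℝ) + 1) / 2) := by
  obtain ⟨e, o, hK, hint⟩ := exists_triangle_coordinates T
  have hb : Bornology.IsBounded (convexHull ℝ (Set.range T.points)) :=
    isBounded_convexHull.2 (Set.finite_range T.points).isBounded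
  have hne : (convexHull ℝ (Set.range T.points)).Nonempty := (Set.range_nonempty _).convexHull
  set K := convexHull ℝ (Set.range T.points)
  obtain ⟨c, hc0, hctop, hc⟩ := e.exists_volume_preimage
  have hvol : volume K = c * ENNReal.ofReal (1 / 2) := by
    rw [← volume_stdTriangle, ← hc _ measurableSet_stdTriangle, hK,
      ← measure_preimage_add_right volume (-o) (e ⁻¹' stdTriangle)]
    simp [Set.preimage, sub_eq_add_neg]
  obtain ⟨γ, hγ, rfl⟩ : ∃ γ : ℝ, 0 < γ ∧ c = ENNReal.ofReal γ :=
    ⟨c.toReal, ENNReal.toReal_pos hc0 hctop, (ENNReal.ofReal_toReal hctop).symm⟩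
  have hj0 : (0 : ℝ) < j := by exact_mod_cast hj
  rw [← ENNReal.ofReal_mul hγ.le] at hvol
  constructor
  · apply le_antisymm
    · refine iSup_le fun Λ => iSup_le fun hΛ => iSup_le fun hpack => ?_
      obtain ⟨D, hD, h0, htop, hu, -⟩ := hΛ.exists_density_eq hb hne
      have hle := le_volume_of_packing e hc hj hΛ hD
        ((isMultiplePacking_iff_coord e o hint j Λ).1 hpack)
      obtain ⟨δ, hδ, hDδ⟩ : ∃ δ : ℝ, 0 < δ ∧ volume D = ENNReal.ofReal δ :=
        ⟨_, ENNReal.toReal_pos h0 htop, (ENNReal.ofReal_toReal htop).symm⟩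
      rw [hDδ, ← ENNReal.ofReal_natCast, ← ENNReal.ofReal_mul hγ.le, ← ENNReal.ofReal_mul hj0.le,
        ENNReal.ofReal_le_ofReal_iff (by positivity), ← mul_div_assoc,
        div_le_iff₀ (by positivity)] at hle
      rw [hu, hvol, hDδ, ← ENNReal.ofReal_div_of_pos hδ]
      refine ENNReal.ofReal_le_ofReal ?_
      rw [div_le_div_iff₀ hδ (by positivity)]
      linarith
    · obtain ⟨Λ, D, hΛ, hDb, hD, hvD, hL⟩ :=
        exists_lattice_coord_eq_congruenceLattice e hc j (N := 2 * j) (by positivity)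
      have := hΛ.countable
      have hpack : IsMultiplePacking j (latticeFamily K Λ) Set.univ := by
        rw [isMultiplePacking_iff_coord e o hint]
        intro p
        simp only [← SetLike.mem_coe, hL]
        exact encard_congruenceLattice_packing hj p
      refine le_trans (le_of_eq ?_) (le_iSup_of_le Λ (le_iSup_of_le hΛ (le_iSup_of_le hpack le_rfl)))
      rw [upperDensity, (tendsto_densityIn hD hDb hb hne).1.limsup_eq, hvol, hvD,
        ← ENNReal.ofReal_mul (by positivity), ← ENNReal.ofReal_div_of_pos (by positivity)]
      congr 1
      field_simp
  · apply le_antisymm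
    · obtain ⟨Λ, D, hΛ, hDb, hD, hvD, hL⟩ :=
        exists_lattice_coord_eq_congruenceLattice e hc j (N := 2 * j + 1) (by positivity)
      have := hΛ.countable
      have hcov : IsMultipleCovering j (latticeFamily K Λ) Set.univ := by
        rw [isMultipleCovering_iff_coord e o hK]
        intro p
        simp only [← SetLike.mem_coe, hL]
        exact encard_congruenceLattice_covering p
      refine (iInf_le_of_le Λ (iInf_le_of_le hΛ (iInf_le_of_le hcov le_rfl))).trans (le_of_eq ?_)
      rw [lowerDensity, (tendsto_densityIn hD hDb hb hne).2.liminf_eq, hvol, hvD,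
        ← ENNReal.ofReal_mul (by positivity), ← ENNReal.ofReal_div_of_pos (by positivity)]
      congr 1
      field_simp
    · refine le_iInf fun Λ => le_iInf fun hΛ => le_iInf fun hcov => ?_
      obtain ⟨D, hD, h0, htop, -, hl⟩ := hΛ.exists_density_eq hb hne
      have hle := volume_le_of_covering e hc hj hΛ hD
        ((isMultipleCovering_iff_coord e o hK j Λ).1 hcov)
      obtain ⟨δ, hδ, hDδ⟩ : ∃ δ : ℝ, 0 < δ ∧ volume D = ENNReal.ofReal δ :=
        ⟨_, ENNReal.toReal_pos h0 htop, (ENNReal.ofReal_toReal htop).symm⟩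
      rw [hDδ, ← ENNReal.ofReal_natCast, ← ENNReal.ofReal_mul hγ.le, ← ENNReal.ofReal_mul hj0.le,
        ENNReal.ofReal_le_ofReal_iff (by positivity), ← mul_div_assoc,
        le_div_iff₀ (by positivity)] at hle
      rw [hl, hvol, hDδ, ← ENNReal.ofReal_div_of_pos hδ]
      refine ENNReal.ofReal_le_ofReal ?_
      rw [div_le_div_iff₀ (by positivity) hδ]
      have : δ * (2 * j + 1) ≤ γ := by
        by_contra! h
        nlinarith
      linarith
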